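/- Let $\mathbb{D}$ be the open unit disc of $\mathbb{C}$, let $dm$ be Lebesgue area measure, and for $0<p<\infty$ let $H^p$ be the Hardy space of analytic functions $h$ in $\mathbb{D}$ with $$\|h\|_{H^p}=\lim_{r\to1^-}\Bigl(\frac1{2\pi}\int_0^{2\pi}|h(re^{i\theta})|^p\,d\theta\Bigr)^{1/p}<\infty .$$ A positive Borel measure $\mu$ on $\mathbb{D}$ is a Carleson measure if there is a constant $C>0$ such that $\int_{\mathbb{D}}|h|^p\,d\mu\le C\,\|h\|_{H^p}^p$ for all $h\in H^p$ (where $0<p<\infty$ is any fixed exponent; the notion does not depend on $p$). Theorem. Let $A$ be analytic in $\mathbb{D}$ and suppose that $|A(z)|(1-|z|^2)\,dm(z)$ is a Carleson measure. Then the zero-sequence $\{z_n\}$ (finite or infinite, zeros listed according to multiplicity) of every non-trivial solution $f\not\equiv0$ of $$f''+Af=0\quad\text{in }\mathbb{D}$$ is uniformly separated, that is, $$\inf_{k}\ \prod_{n\ne k}\left|\frac{z_n-z_k}{1-\overline{z}_n z_k}\right|>0 .$$ -/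

import Mathlib

open MeasureTheory Filter Topology
open scoped ENNReal NNReal ComplexConjugate

noncomputable section

namespace DiskODE

/-- The open unit disc `𝔻` of the complex plane. -/
abbrev disc : Set ℂ := Metric.ball (0 : ℂ) 1

/-- The integral mean `(1/2π) ∫₀^{2π} |f(r e^{iθ})|^p dθ`, with values in `[0,∞]`. -/
def circleMean (p : ℝ) (f : ℂ → ℂ) (r : ℝ) : ℝ≥0∞ :=
  ENNReal.ofReal (1 / (2 * Real.pi)) *
    ∫⁻ θ in Set.Icc (0 : ℝ) (2 * Real.pi),
      ENNReal.ofReal (‖f (r * Complex.exp (θ * Complex.I))‖ ^ p)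

/-- The Hardy norm `‖f‖_{H^p}`, with values in `[0,∞]`. For analytic `f` the integral means are
nondecreasing in `r`, so that the upper limit is a limit. -/
def hardyNorm (p : ℝ) (f : ℂ → ℂ) : ℝ≥0∞ :=
  (limsup (fun r : ℝ => circleMean p f r ^ (1 / p)) (𝓝[<] (1 : ℝ)))

/-- Membership in the Hardy space `H^p` of the unit disc. -/
def MemHardy (p : ℝ) (f : ℂ → ℂ) : Prop :=
  DifferentiableOn ℂ f disc ∧ hardyNorm p f < ∞

/-- `μ` is a Carleson measure on the unit disc (tested on the Hardy space `H^p`):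
`∫_𝔻 |f|^p dμ ≤ C ‖f‖_{H^p}^p` for all `f ∈ H^p`. -/
def IsCarlesonMeasure (p : ℝ) (μ : Measure ℂ) : Prop :=
  ∃ C : ℝ≥0, 0 < C ∧ ∀ f : ℂ → ℂ, MemHardy p f →
    ∫⁻ z in disc, ENNReal.ofReal (‖f z‖ ^ p) ∂μ ≤ C * hardyNorm p f ^ p

/-- The measure `|A(z)| (1 - |z|²) dm(z)` on the unit disc, `dm` being Lebesgue area measure. -/
def coeffMeasure (A : ℂ → ℂ) : Measure ℂ :=
  (volume.restrict disc).withDensity fun z => ENNReal.ofReal (‖A z‖ * (1 - ‖z‖ ^ 2))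

/-- `f` is an (analytic) solution of `f'' + A f = 0` in the unit disc. -/
def IsSolution (A f : ℂ → ℂ) : Prop :=
  DifferentiableOn ℂ f disc ∧ ∀ z ∈ disc, deriv (deriv f) z + A z * f z = 0

/-- The family `z` (finite or infinite) lists the zeros of `f` in the unit disc,
each one as many times as its multiplicity. -/
def IsZeroSequence {ι : Type*} (f : ℂ → ℂ) (z : ι → ℂ) : Prop :=
  (∀ i, z i ∈ disc) ∧ ∀ w ∈ disc, {i | z i = w}.encard = analyticOrderAt f w

/-- The pseudo-hyperbolic distance `|z - w| / |1 - z̄ w|`. -/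
def pseudoDist (z w : ℂ) : ℝ :=
  ‖(z - w) / (1 - conj z * w)‖

/-- `inf_k ∏_{n ≠ k} |z_n - z_k| / |1 - z̄_n z_k| > 0`, the products being required to exist
(for points of the disc they always do, as the factors lie in `[0,1]`; they may be `0`). -/
def UniformlySeparated {ι : Type*} (z : ι → ℂ) : Prop :=
  ∃ δ : ℝ, 0 < δ ∧ ∀ k : ι,
    Multipliable (fun n : {n : ι // n ≠ k} => pseudoDist (z n) (z k)) ∧
      δ ≤ ∏' n : {n : ι // n ≠ k}, pseudoDist (z n) (z k)

end DiskODE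

end

/-!
A disc automorphism `φ` takes the origin to a given zero `z_k` of `f`. The equation is conformally
covariant: `u = (f ∘ φ) (φ')^(-1/2)` solves `u'' + B u = 0` with `B = (A ∘ φ) (φ')²`, and the
Carleson condition, tested on a function `h` with `|h|^p = |φ'|`, whose Hardy norm is at most `1`,
becomes the bound `∫ |B| (1 - |z|²) dm ≤ C`, uniform in `k`.

Now `u` has a simple zero at the origin. A Grönwall argument along radii gives
`log |u(r e^{iθ}) / (r u'(0))| ≤ ∫₀^r |B(s e^{iθ})| (1 - s²) s ds`, whose average over `θ` is at
most `C / 2π`. Jensen's formula turns this into a bound for the other zeros of `u`, whose moduli are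
the pseudo-hyperbolic distances `ρ(z_n, z_k)`: their product is at least `exp (-C / 2π)`.
-/

namespace DiskODE

section Gronwall

variable {E : Type*} [NormedAddCommGroup E] [NormedSpace ℝ E]

lemma hasDerivAt_integral_of_continuousOn_Icc [CompleteSpace E] {k : ℝ → E} {a b : ℝ}
    (hk : ContinuousOn k (Set.Icc a b)) {t : ℝ} (ht : t ∈ Set.Ioo a b) :
    HasDerivAt (fun t => ∫ s in a..t, k s) (k t) t := by
  refine intervalIntegral.integral_hasDerivAt_right ?_ ?_ (hk.continuousAt (Icc_mem_nhds ht.1 ht.2))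
  · refine (hk.mono ?_).intervalIntegrable
    rw [Set.uIcc_of_le ht.1.le]
    exact Set.Icc_subset_Icc_right ht.2.le
  · exact (hk.mono Set.Ioo_subset_Icc_self).stronglyMeasurableAtFilter isOpen_Ioo t ht

lemma continuousOn_integral_of_continuousOn_Icc {k : ℝ → E} {a b : ℝ} (hab : a ≤ b)
    (hk : ContinuousOn k (Set.Icc a b)) :
    ContinuousOn (fun t => ∫ s in a..t, k s) (Set.Icc a b) := by
  rw [← Set.uIcc_of_le hab] at hk ⊢
  exact intervalIntegral.continuousOn_primitive_interval hk.integrableOn_uIcc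

theorem le_mul_exp_integral_of_deriv_le {y y' k : ℝ → ℝ} {a b : ℝ} (hab : a ≤ b)
    (hk : ContinuousOn k (Set.Icc a b)) (hy : ContinuousOn y (Set.Icc a b))
    (hy' : ∀ t ∈ Set.Ioo a b, HasDerivAt y (y' t) t) (h : ∀ t ∈ Set.Ioo a b, y' t ≤ k t * y t) :
    y b ≤ y a * Real.exp (∫ t in a..b, k t) := by
  have hd : ∀ t ∈ Set.Ioo a b, HasDerivAt (fun t => y t * Real.exp (-∫ s in a..t, k s))
      (y' t * Real.exp (-∫ s in a..t, k s) + y t * (Real.exp (-∫ s in a..t, k s) * -k t)) t :=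
    fun t ht => (hy' t ht).mul (hasDerivAt_integral_of_continuousOn_Icc hk ht).neg.exp
  have hanti : AntitoneOn (fun t => y t * Real.exp (-∫ s in a..t, k s)) (Set.Icc a b) := by
    refine antitoneOn_of_deriv_nonpos (convex_Icc a b)
      (hy.mul (continuousOn_integral_of_continuousOn_Icc hab hk).neg.rexp)
      (fun t ht => ?_) (fun t ht => ?_) <;> rw [interior_Icc] at ht
    · exact (hd t ht).differentiableAt.differentiableWithinAt
    · rw [(hd t ht).deriv]
      nlinarith [h t ht, Real.exp_pos (-∫ s in a..t, k s)]
  have hle := hanti (Set.left_mem_Icc.2 hab) (Set.right_mem_Icc.2 hab) hab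
  simpa [Real.exp_neg, ← div_eq_mul_inv, div_le_iff₀ (Real.exp_pos _)] using hle

variable [CompleteSpace E] {U U' U'' : ℝ → E} {β : ℝ → ℝ} {r : ℝ}

lemma eq_add_smul_add_integral_of_hasDerivAt (hr : 0 ≤ r)
    (hU : ∀ s ∈ Set.Icc 0 r, HasDerivAt U (U' s) s)
    (hU' : ∀ s ∈ Set.Icc 0 r, HasDerivAt U' (U'' s) s) (hc : ContinuousOn U'' (Set.Icc 0 r)) :
    U r = U 0 + r • U' 0 + ∫ s in (0 : ℝ)..r, (r - s) • U'' s := by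
  rw [← Set.uIcc_of_le hr] at hU hU' hc
  have hd : ∀ s ∈ Set.uIcc 0 r, HasDerivAt (fun s => (r - s) • U' s + U s) ((r - s) • U'' s) s :=
    fun s hs => ((((hasDerivAt_id s).const_sub r).smul (hU' s hs)).add (hU s hs)).congr_deriv
      (by simp)
  rw [intervalIntegral.integral_eq_sub_of_hasDerivAt hd
    (ContinuousOn.intervalIntegrable (by fun_prop))]
  simp [add_comm]

lemma norm_le_mul_add_integral_of_norm_deriv_deriv_le (hr : 0 < r)
    (hU : ∀ s ∈ Set.Icc 0 r, HasDerivAt U (U' s) s)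
    (hU' : ∀ s ∈ Set.Icc 0 r, HasDerivAt U' (U'' s) s) (hc : ContinuousOn U'' (Set.Icc 0 r))
    (hβ : ContinuousOn β (Set.Icc 0 r)) (h : ∀ s ∈ Set.Icc 0 r, ‖U'' s‖ ≤ β s * ‖U s‖)
    (h0 : U 0 = 0) {t : ℝ} (ht : t ∈ Set.Icc 0 r) :
    ‖U t‖ ≤ t * (‖U' 0‖ + ∫ s in (0 : ℝ)..t, (1 - s / r) * (β s * ‖U s‖)) := by
  have hsub : Set.Icc 0 t ⊆ Set.Icc 0 r := Set.Icc_subset_Icc_right ht.2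
  rw [eq_add_smul_add_integral_of_hasDerivAt ht.1 (fun s hs => hU s (hsub hs))
    (fun s hs => hU' s (hsub hs)) (hc.mono hsub), h0, zero_add, mul_add,
    ← intervalIntegral.integral_const_mul]
  refine (norm_add_le _ _).trans (add_le_add ?_ ?_)
  · rw [norm_smul, Real.norm_of_nonneg ht.1]
  refine intervalIntegral.norm_integral_le_of_norm_le ht.1 (Eventually.of_forall fun s hs => ?_)
    (ContinuousOn.intervalIntegrable ?_)
  · have hts : 0 ≤ t - s := sub_nonneg.2 hs.2
    have hst : t - s ≤ t * (1 - s / r) := by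
      have : t / r ≤ 1 := (div_le_one hr).2 ht.2
      nlinarith [hs.1, mul_div_right_comm t s r, mul_div_assoc t s r]
    calc ‖(t - s) • U'' s‖ = (t - s) * ‖U'' s‖ := by rw [norm_smul, Real.norm_of_nonneg hts]
      _ ≤ t * (1 - s / r) * (β s * ‖U s‖) :=
          mul_le_mul hst (h s (hsub (Set.Ioc_subset_Icc_self hs))) (norm_nonneg _) (hts.trans hst)
      _ = t * ((1 - s / r) * (β s * ‖U s‖)) := mul_assoc _ _ _
  · rw [Set.uIcc_of_le ht.1]
    have hUc : ContinuousOn U (Set.Icc 0 t) := (HasDerivAt.continuousOn hU).mono hsub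
    have hβc := hβ.mono hsub
    fun_prop

theorem norm_le_mul_exp_integral_of_norm_deriv_deriv_le (hr : 0 < r)
    (hU : ∀ s ∈ Set.Icc 0 r, HasDerivAt U (U' s) s)
    (hU' : ∀ s ∈ Set.Icc 0 r, HasDerivAt U' (U'' s) s) (hc : ContinuousOn U'' (Set.Icc 0 r))
    (hβ : ContinuousOn β (Set.Icc 0 r)) (hβ0 : ∀ s ∈ Set.Icc 0 r, 0 ≤ β s)
    (h : ∀ s ∈ Set.Icc 0 r, ‖U'' s‖ ≤ β s * ‖U s‖) (h0 : U 0 = 0) :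
    ‖U r‖ ≤ r * ‖U' 0‖ * Real.exp (∫ s in (0 : ℝ)..r, s * ((1 - s / r) * β s)) := by
  have hg : ContinuousOn (fun s => (1 - s / r) * (β s * ‖U s‖)) (Set.Icc 0 r) := by
    have := HasDerivAt.continuousOn hU
    fun_prop
  let Y : ℝ → ℝ := fun t => ‖U' 0‖ + ∫ s in (0 : ℝ)..t, (1 - s / r) * (β s * ‖U s‖)
  have hUY : ∀ t ∈ Set.Icc 0 r, ‖U t‖ ≤ t * Y t := fun t ht =>
    norm_le_mul_add_integral_of_norm_deriv_deriv_le hr hU hU' hc hβ h h0 ht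
  have hY : Y r ≤ Y 0 * Real.exp (∫ s in (0 : ℝ)..r, s * ((1 - s / r) * β s)) := by
    refine le_mul_exp_integral_of_deriv_le hr.le (by fun_prop)
      (continuousOn_const.add (continuousOn_integral_of_continuousOn_Icc hr.le hg))
      (fun t ht => (hasDerivAt_integral_of_continuousOn_Icc hg ht).const_add _) fun t ht => ?_
    have h1 : 0 ≤ 1 - t / r := sub_nonneg.2 ((div_le_one hr).2 ht.2.le)
    have h2 : 0 ≤ β t := hβ0 t (Set.Ioo_subset_Icc_self ht)
    calc (1 - t / r) * (β t * ‖U t‖) ≤ (1 - t / r) * (β t * (t * Y t)) := by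
          gcongr
          exact hUY t (Set.Ioo_subset_Icc_self ht)
      _ = t * ((1 - t / r) * β t) * Y t := by ring
  calc ‖U r‖ ≤ r * Y r := hUY r (Set.right_mem_Icc.2 hr.le)
    _ ≤ r * (Y 0 * Real.exp (∫ s in (0 : ℝ)..r, s * ((1 - s / r) * β s))) := by gcongr
    _ = _ := by simp only [Y, intervalIntegral.integral_same, add_zero, mul_assoc]

end Gronwall

lemma multipliable_and_le_tprod_of_forall_le_prod {κ : Type*} {x : κ → ℝ} {δ : ℝ}
    (h0 : ∀ i, 0 ≤ x i) (h1 : ∀ i, x i ≤ 1) (hδ : ∀ s : Finset κ, δ ≤ ∏ i ∈ s, x i) :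
    Multipliable x ∧ δ ≤ ∏' i, x i := by
  have hanti : Antitone fun s : Finset κ => ∏ i ∈ s, x i := fun s t hst =>
    Finset.prod_le_prod_of_subset_of_le_one hst (fun i _ => h0 i) (fun i _ _ => h1 i)
  have hprod : HasProd x (⨅ s : Finset κ, ∏ i ∈ s, x i) :=
    tendsto_atTop_ciInf hanti ⟨δ, Set.forall_mem_range.2 hδ⟩
  exact ⟨hprod.multipliable, hprod.tprod_eq ▸ le_ciInf hδ⟩

section Jensen

lemma sum_le_finsum_of_nonneg {α M : Type*} [AddCommMonoid M] [PartialOrder M]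
    [IsOrderedAddMonoid M] {f g : α → M} (hg : g.support.Finite) (hg0 : ∀ x, 0 ≤ g x)
    {s : Finset α} (hfg : ∀ x ∈ s, f x ≤ g x) : ∑ x ∈ s, f x ≤ ∑ᶠ x, g x := by
  classical
  rw [finsum_eq_sum_of_support_subset (s := hg.toFinset ∪ s) g (by simp [Set.subset_union_left])]
  exact (Finset.sum_le_sum hfg).trans
    (Finset.sum_le_sum_of_subset_of_nonneg Finset.subset_union_right fun x _ _ => hg0 x)

variable {g : ℂ → ℂ} {c : ℂ} {R : ℝ}

lemma one_le_divisor_of_eq_zero {U : Set ℂ} (hU : IsPreconnected U) (hg : AnalyticOnNhd ℂ g U)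
    (hc : c ∈ U) (hgc : g c ≠ 0) {w : ℂ} (hw : w ∈ U) (hgw : g w = 0) :
    1 ≤ MeromorphicOn.divisor g U w := by
  have hc' : analyticOrderAt g c ≠ ⊤ := by simp [(hg c hc).analyticOrderAt_eq_zero.2 hgc]
  have hne : analyticOrderAt g w ≠ 0 := (hg w hw).analyticOrderAt_ne_zero.2 hgw
  rw [MeromorphicOn.AnalyticOnNhd.divisor_apply hg hw]
  lift analyticOrderAt g w to ℕ using
    hg.analyticOrderAt_ne_top_of_isPreconnected hU hc hw hc' with n
  simpa [Nat.one_le_iff_ne_zero] using hne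

lemma log_mul_inv_norm_sub_nonneg {w : ℂ} (hw : w ∈ Metric.closedBall c R) :
    0 ≤ Real.log (R * ‖c - w‖⁻¹) := by
  rw [mem_closedBall_iff_norm'] at hw
  rcases (norm_nonneg (c - w)).eq_or_lt with h | h
  · simp [← h]
  · exact Real.log_nonneg (by rwa [← div_eq_mul_inv, one_le_div h])

theorem sum_log_le_circleAverage_log_norm (hR : 0 < R)
    (hg : AnalyticOnNhd ℂ g (Metric.closedBall c R)) (hgc : g c ≠ 0) {F : Finset ℂ}
    (hF : ∀ w ∈ F, w ∈ Metric.closedBall c R) (hF0 : ∀ w ∈ F, g w = 0) :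
    ∑ w ∈ F, Real.log (R * ‖c - w‖⁻¹) + Real.log ‖g c‖ ≤
      Real.circleAverage (Real.log ‖g ·‖) c R := by
  have hball : Metric.closedBall c |R| = Metric.closedBall c R := by rw [abs_of_pos hR]
  rw [AnalyticOnNhd.circleAverage_log_norm hR.ne' (by rwa [hball]) hgc, hball]
  gcongr
  refine sum_le_finsum_of_nonneg ?_ (fun w => ?_) fun w hw => ?_
  · refine ((MeromorphicOn.divisor g _).finiteSupport (isCompact_closedBall c R)).subset
      fun w hw h => hw ?_
    exact mul_eq_zero_of_left (Int.cast_eq_zero.2 h) _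
  · by_cases hw : w ∈ Metric.closedBall c R
    · exact mul_nonneg (mod_cast MeromorphicOn.AnalyticOnNhd.divisor_nonneg hg w)
        (log_mul_inv_norm_sub_nonneg hw)
    · simp [Function.locallyFinsuppWithin.apply_eq_zero_of_notMem _ hw]
  · exact le_mul_of_one_le_left (log_mul_inv_norm_sub_nonneg (hF w hw))
      (mod_cast one_le_divisor_of_eq_zero (convex_closedBall c R).isPreconnected hg
        (Metric.mem_closedBall_self hR.le) hgc (hF w hw) (hF0 w hw))

end Jensen

section Mobius

/-- The involutive automorphism of the unit disc interchanging `0` and `a`. -/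
noncomputable def mobius (a z : ℂ) : ℂ := (a - z) / (1 - conj a * z)

variable {a z : ℂ}

@[simp] lemma mobius_zero (a : ℂ) : mobius a 0 = a := by simp [mobius]

@[simp] lemma mobius_self (a : ℂ) : mobius a a = 0 := by simp [mobius]

lemma re_one_sub_conj_mul_pos (ha : a ∈ disc) (hz : z ∈ disc) : 0 < (1 - conj a * z).re := by
  rw [mem_ball_zero_iff] at ha hz
  have h : (conj a * z).re ≤ ‖a‖ * ‖z‖ := by
    simpa using Complex.re_le_norm (conj a * z)
  rw [Complex.sub_re, Complex.one_re, sub_pos]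
  exact h.trans_lt (mul_lt_one_of_nonneg_of_lt_one_left (norm_nonneg a) ha hz.le)

lemma one_sub_conj_mul_ne_zero (ha : a ∈ disc) (hz : z ∈ disc) : 1 - conj a * z ≠ 0 := fun h => by
  simpa [h] using re_one_sub_conj_mul_pos ha hz

lemma one_sub_norm_sq_pos (hz : z ∈ disc) : 0 < 1 - ‖z‖ ^ 2 := by
  rw [mem_ball_zero_iff] at hz
  exact sub_pos.2 (pow_lt_one₀ (norm_nonneg z) hz two_ne_zero)

lemma norm_one_sub_conj_mul_self (ha : a ∈ disc) : ‖1 - conj a * a‖ = 1 - ‖a‖ ^ 2 := by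
  rw [Complex.conj_mul']
  exact_mod_cast Real.norm_of_nonneg (one_sub_norm_sq_pos ha).le

lemma hasDerivAt_one_sub_conj_mul (a z : ℂ) :
    HasDerivAt (fun z => 1 - conj a * z) (-conj a) z := by
  simpa using ((hasDerivAt_id z).const_mul (conj a)).const_sub 1

lemma hasDerivAt_mobius (ha : a ∈ disc) (hz : z ∈ disc) :
    HasDerivAt (mobius a) (-(1 - conj a * a) / (1 - conj a * z) ^ 2) z :=
  (((hasDerivAt_id z).const_sub a).div (hasDerivAt_one_sub_conj_mul a z)
    (one_sub_conj_mul_ne_zero ha hz)).congr_deriv (by simp only [id]; ring)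

lemma norm_deriv_mobius (ha : a ∈ disc) (hz : z ∈ disc) :
    ‖deriv (mobius a) z‖ = (1 - ‖a‖ ^ 2) / ‖1 - conj a * z‖ ^ 2 := by
  rw [(hasDerivAt_mobius ha hz).deriv, norm_div, norm_neg, norm_one_sub_conj_mul_self ha, norm_pow]

lemma differentiableOn_mobius (ha : a ∈ disc) : DifferentiableOn ℂ (mobius a) disc :=
  fun _ hz => (hasDerivAt_mobius ha hz).differentiableAt.differentiableWithinAt

lemma differentiableOn_deriv_mobius (ha : a ∈ disc) :
    DifferentiableOn ℂ (deriv (mobius a)) disc :=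
  (differentiableOn_mobius ha).deriv Metric.isOpen_ball

lemma one_sub_norm_mobius_sq (ha : a ∈ disc) (hz : z ∈ disc) :
    1 - ‖mobius a z‖ ^ 2 = ‖deriv (mobius a) z‖ * (1 - ‖z‖ ^ 2) := by
  have h : ‖1 - conj a * z‖ ^ 2 ≠ 0 := by simpa using one_sub_conj_mul_ne_zero ha hz
  rw [norm_deriv_mobius ha hz, mobius, norm_div, div_pow, div_mul_eq_mul_div, eq_div_iff h,
    sub_mul, div_mul_cancel₀ _ h]
  simp only [← Complex.normSq_eq_norm_sq, Complex.normSq_apply, Complex.sub_re, Complex.sub_im,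
    Complex.mul_re, Complex.mul_im, Complex.conj_re, Complex.conj_im, Complex.one_re,
    Complex.one_im]
  ring

lemma mobius_mem_disc (ha : a ∈ disc) (hz : z ∈ disc) : mobius a z ∈ disc := by
  have hpos : 0 < 1 - ‖mobius a z‖ ^ 2 := by
    rw [one_sub_norm_mobius_sq ha hz, norm_deriv_mobius ha hz]
    have := one_sub_conj_mul_ne_zero ha hz
    exact mul_pos (div_pos (one_sub_norm_sq_pos ha) (by positivity)) (one_sub_norm_sq_pos hz)
  rw [mem_ball_zero_iff]
  exact (pow_lt_one_iff_of_nonneg (norm_nonneg _) two_ne_zero).1 (sub_pos.1 hpos)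

lemma one_sub_conj_mul_mobius (ha : a ∈ disc) (hz : z ∈ disc) :
    1 - conj a * mobius a z = (1 - conj a * a) / (1 - conj a * z) := by
  have h := one_sub_conj_mul_ne_zero ha hz
  rw [mobius]
  field_simp
  ring

lemma mobius_mobius (ha : a ∈ disc) (hz : z ∈ disc) : mobius a (mobius a z) = z := by
  have h := one_sub_conj_mul_ne_zero ha hz
  rw [mobius, one_sub_conj_mul_mobius ha hz, mobius, div_div_eq_mul_div,
    div_eq_iff (one_sub_conj_mul_ne_zero ha ha), sub_mul, div_mul_cancel₀ _ h]
  ring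

lemma injOn_mobius (ha : a ∈ disc) : Set.InjOn (mobius a) disc :=
  Set.LeftInvOn.injOn (f₁' := mobius a) fun _ hz => mobius_mobius ha hz

lemma image_mobius_disc (ha : a ∈ disc) : mobius a '' disc = disc :=
  Set.Subset.antisymm (Set.image_subset_iff.2 fun _ hz => mobius_mem_disc ha hz)
    fun z hz => ⟨mobius a z, mobius_mem_disc ha hz, mobius_mobius ha hz⟩

lemma norm_deriv_mobius_mobius_mul (ha : a ∈ disc) (hz : z ∈ disc) :
    ‖deriv (mobius a) (mobius a z)‖ * ‖deriv (mobius a) z‖ = 1 := by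
  have h : ‖1 - conj a * z‖ ≠ 0 := norm_ne_zero_iff.2 (one_sub_conj_mul_ne_zero ha hz)
  have ha' := (one_sub_norm_sq_pos ha).ne'
  rw [norm_deriv_mobius ha (mobius_mem_disc ha hz), norm_deriv_mobius ha hz,
    one_sub_conj_mul_mobius ha hz, norm_div, norm_one_sub_conj_mul_self ha]
  field_simp

lemma pseudoDist_eq_norm_mobius (z a : ℂ) : pseudoDist z a = ‖mobius a z‖ := by
  have h : ‖1 - conj z * a‖ = ‖1 - conj a * z‖ := by
    rw [← RCLike.norm_conj]
    simp [mul_comm]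
  rw [pseudoDist, mobius, norm_div, norm_div, h, norm_sub_rev]

lemma pseudoDist_le_one (hz : z ∈ disc) (ha : a ∈ disc) : pseudoDist z a ≤ 1 := by
  rw [pseudoDist_eq_norm_mobius]
  exact (mem_ball_zero_iff.1 (mobius_mem_disc ha hz)).le

end Mobius

section Solutions

variable {A f : ℂ → ℂ} {a z : ℂ}

lemma IsSolution.hasDerivAt (hf : IsSolution A f) (hz : z ∈ disc) : HasDerivAt f (deriv f z) z :=
  (hf.1.differentiableAt (Metric.isOpen_ball.mem_nhds hz)).hasDerivAt

lemma IsSolution.hasDerivAt_deriv (hf : IsSolution A f) (hz : z ∈ disc) :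
    HasDerivAt (deriv f) (-(A z * f z)) z :=
  ((hf.1.deriv Metric.isOpen_ball).differentiableAt
    (Metric.isOpen_ball.mem_nhds hz)).hasDerivAt.congr_deriv
      (eq_neg_of_add_eq_zero_left (hf.2 z hz))

lemma IsSolution.analyticOnNhd (hf : IsSolution A f) : AnalyticOnNhd ℂ f disc :=
  hf.1.analyticOnNhd Metric.isOpen_ball

lemma IsSolution.analyticOrderAt_ne_top (hf : IsSolution A f) (hf0 : ∃ z ∈ disc, f z ≠ 0)
    (ha : a ∈ disc) : analyticOrderAt f a ≠ ⊤ := by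
  obtain ⟨z, hz, hfz⟩ := hf0
  refine hf.analyticOnNhd.analyticOrderAt_ne_top_of_isPreconnected
    (convex_ball 0 1).isPreconnected hz ha ?_
  simp [(hf.analyticOnNhd z hz).analyticOrderAt_eq_zero.2 hfz]

lemma IsSolution.deriv_ne_zero (hA : DifferentiableOn ℂ A disc) (hf : IsSolution A f)
    (hf0 : ∃ z ∈ disc, f z ≠ 0) (ha : a ∈ disc) (hfa : f a = 0) : deriv f a ≠ 0 := by
  intro hfa'
  have hf_an := hf.analyticOnNhd a ha
  have hA_an : AnalyticAt ℂ A a := hA.analyticAt (Metric.isOpen_ball.mem_nhds ha)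
  have hode : deriv (deriv f) =ᶠ[𝓝 a] -(A * f) := by
    filter_upwards [Metric.isOpen_ball.mem_nhds ha] with z hz
    exact (hf.hasDerivAt_deriv hz).deriv
  have h1 : analyticOrderAt (deriv f) a + 1 = analyticOrderAt f a := by
    simpa [hfa] using hf_an.analyticOrderAt_deriv_add_one
  have h2 : analyticOrderAt A a + analyticOrderAt f a + 1 = analyticOrderAt (deriv f) a := by
    simpa [hfa', analyticOrderAt_congr hode, analyticOrderAt_neg,
      analyticOrderAt_mul hA_an hf_an] using hf_an.deriv.analyticOrderAt_deriv_add_one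
  have hne := hf.analyticOrderAt_ne_top hf0 ha
  rw [← h2] at h1
  lift analyticOrderAt f a to ℕ using hne with n
  have hlt : (n : ℕ∞) < n + 1 := mod_cast n.lt_succ_self
  refine (hlt.trans_le ?_).ne' h1
  gcongr
  exact le_add_self.trans le_self_add

lemma IsSolution.analyticOrderAt_eq_one (hA : DifferentiableOn ℂ A disc) (hf : IsSolution A f)
    (hf0 : ∃ z ∈ disc, f z ≠ 0) (ha : a ∈ disc) (hfa : f a = 0) : analyticOrderAt f a = 1 :=
  (hf.analyticOnNhd a ha).analyticOrderAt_eq_one_of_zero_deriv_ne_zero hfa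
    (hf.deriv_ne_zero hA hf0 ha hfa)

/-- The coefficient `(A ∘ φ) φ'²` of the equation solved by `solutionPullback f a`, where
`φ = mobius a`. -/
noncomputable def coeffPullback (A : ℂ → ℂ) (a z : ℂ) : ℂ := A (mobius a z) * deriv (mobius a) z ^ 2

/-- The function `(f ∘ φ) (φ')^(-1/2)` for `φ = mobius a`, up to a constant factor: the factor
`1 - conj a * z` stands for `(φ')^(-1/2)`, which avoids a choice of square root. -/
noncomputable def solutionPullback (f : ℂ → ℂ) (a z : ℂ) : ℂ := f (mobius a z) * (1 - conj a * z)

@[simp] lemma solutionPullback_zero (f : ℂ → ℂ) (a : ℂ) : solutionPullback f a 0 = f a := by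
  simp [solutionPullback]

lemma solutionPullback_mobius (f : ℂ → ℂ) (ha : a ∈ disc) (hz : z ∈ disc) :
    solutionPullback f a (mobius a z) = f z * (1 - conj a * mobius a z) := by
  rw [solutionPullback, mobius_mobius ha hz]

lemma differentiableOn_coeffPullback (hA : DifferentiableOn ℂ A disc) (ha : a ∈ disc) :
    DifferentiableOn ℂ (coeffPullback A a) disc :=
  (hA.comp (differentiableOn_mobius ha) fun _ hz => mobius_mem_disc ha hz).mul
    ((differentiableOn_deriv_mobius ha).pow 2)

lemma IsSolution.hasDerivAt_solutionPullback (hf : IsSolution A f) (ha : a ∈ disc)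
    (hz : z ∈ disc) :
    HasDerivAt (solutionPullback f a) (deriv f (mobius a z) *
      (-(1 - conj a * a) / (1 - conj a * z)) + f (mobius a z) * -conj a) z := by
  have h := one_sub_conj_mul_ne_zero ha hz
  refine (((hf.hasDerivAt (mobius_mem_disc ha hz)).comp z (hasDerivAt_mobius ha hz)).mul
    (hasDerivAt_one_sub_conj_mul a z)).congr_deriv ?_
  simp only [Function.comp_apply]
  field_simp

lemma IsSolution.hasDerivAt_deriv_solutionPullback (hf : IsSolution A f) (ha : a ∈ disc)
    (hz : z ∈ disc) :
    HasDerivAt (deriv (solutionPullback f a))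
      (-(coeffPullback A a z * solutionPullback f a z)) z := by
  have h := one_sub_conj_mul_ne_zero ha hz
  have hφz := mobius_mem_disc ha hz
  have hφ := hasDerivAt_mobius ha hz
  have hq : HasDerivAt (fun z => -(1 - conj a * a) / (1 - conj a * z))
      (-((1 - conj a * a) * conj a) / (1 - conj a * z) ^ 2) z :=
    ((hasDerivAt_const z (-(1 - conj a * a))).div (hasDerivAt_one_sub_conj_mul a z) h).congr_deriv
      (by ring)
  refine (((((hf.hasDerivAt_deriv hφz).comp z hφ).mul hq).add
    (((hf.hasDerivAt hφz).comp z hφ).mul_const (-conj a))).congr_deriv ?_).congr_of_eventuallyEq ?_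
  · simp only [Function.comp_apply, coeffPullback, solutionPullback, hφ.deriv]
    field_simp
    ring
  · filter_upwards [Metric.isOpen_ball.mem_nhds hz] with w hw
    exact (hf.hasDerivAt_solutionPullback ha hw).deriv

lemma IsSolution.solutionPullback (hf : IsSolution A f) (ha : a ∈ disc) :
    IsSolution (coeffPullback A a) (solutionPullback f a) :=
  ⟨fun _ hz =>
    (hf.hasDerivAt_solutionPullback ha hz).differentiableAt.differentiableWithinAt,
    fun z hz => by rw [(hf.hasDerivAt_deriv_solutionPullback ha hz).deriv, neg_add_cancel]⟩

lemma IsSolution.deriv_solutionPullback_zero_ne_zero (hA : DifferentiableOn ℂ A disc)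
    (hf : IsSolution A f) (hf0 : ∃ z ∈ disc, f z ≠ 0) (ha : a ∈ disc) (hfa : f a = 0) :
    deriv (DiskODE.solutionPullback f a) 0 ≠ 0 := by
  rw [(hf.hasDerivAt_solutionPullback ha (Metric.mem_ball_self one_pos)).deriv]
  have h := neg_ne_zero.2 (one_sub_conj_mul_ne_zero ha ha)
  simpa [hfa, hf.deriv_ne_zero hA hf0 ha hfa] using h

lemma IsZeroSequence.apply_eq_zero {ι : Type*} {z : ι → ℂ} (hz : IsZeroSequence f z) (i : ι) :
    f (z i) = 0 := by
  refine apply_eq_zero_of_analyticOrderAt_ne_zero fun h => ?_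
  rw [← hz.2 _ (hz.1 i), Set.encard_eq_zero] at h
  exact Set.eq_empty_iff_forall_notMem.1 h i rfl

lemma IsZeroSequence.injective {ι : Type*} {z : ι → ℂ} (hA : DifferentiableOn ℂ A disc)
    (hf : IsSolution A f) (hf0 : ∃ z ∈ disc, f z ≠ 0) (hz : IsZeroSequence f z) :
    Function.Injective z := by
  intro i j hij
  have h := hz.2 (z j) (hz.1 j)
  rw [hf.analyticOrderAt_eq_one hA hf0 (hz.1 j) (hz.apply_eq_zero j)] at h
  exact Set.encard_le_one_iff.1 h.le i j hij rfl

end Solutions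

section Hardy

variable {p r : ℝ} {a z : ℂ}

lemma circleMean_eq_ofReal_circleAverage {f : ℂ → ℂ} (hp : 0 ≤ p)
    (hf : ContinuousOn f (Metric.sphere 0 |r|)) :
    circleMean p f r = ENNReal.ofReal (Real.circleAverage (fun z => ‖f z‖ ^ p) 0 r) := by
  have hc : Continuous fun θ => ‖f (circleMap 0 r θ)‖ ^ p :=
    (hf.comp_continuous (continuous_circleMap 0 r)
      (circleMap_mem_sphere' 0 r)).norm.rpow_const fun _ => Or.inr hp
  simp only [circleMean, ← circleMap_zero]
  rw [Real.circleAverage_def, smul_eq_mul, ENNReal.ofReal_mul (by positivity), one_div,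
    intervalIntegral.integral_of_le Real.two_pi_pos.le, ← integral_Icc_eq_integral_Ioc,
    ofReal_integral_eq_lintegral_ofReal hc.integrableOn_Icc
      (Eventually.of_forall fun _ => by positivity)]

lemma circleAverage_poissonKernel {w : ℂ} (hw : w ∈ Metric.ball 0 r) :
    Real.circleAverage (poissonKernel 0 w) 0 r = 1 := by
  simpa [← Pi.one_def] using
    (InnerProductSpace.harmonicContOnCl_const (c := (1 : ℝ))).circleAverage_poissonKernel_smul hw

/-- `r² a` is the reflection across the circle `|z| = r` of the pole `1 / conj a`. -/
lemma poissonKernel_sq_mul (hr : r ≠ 0) (hz : ‖z‖ = r) :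
    poissonKernel 0 (r ^ 2 * a) z = (1 - (r * ‖a‖) ^ 2) / ‖1 - conj a * z‖ ^ 2 := by
  have h : ‖z - r ^ 2 * a‖ = r * ‖1 - conj a * z‖ := by
    have hzz : z * conj z = r ^ 2 := by rw [Complex.mul_conj', hz]
    rw [← hzz, ← hz, ← RCLike.norm_conj (1 - _), ← norm_mul]
    simp only [map_sub, map_one, map_mul, Complex.conj_conj]
    ring_nf
  rw [poissonKernel_def]
  simp only [sub_zero, norm_mul, norm_pow, Complex.norm_real, h, hz, Real.norm_eq_abs, sq_abs]
  rw [mul_pow r, ← mul_div_mul_left (1 - _) _ (pow_ne_zero 2 hr)]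
  ring_nf

lemma circleAverage_norm_deriv_mobius_le_one (ha : a ∈ disc) (hr : r ∈ Set.Ioo 0 1) :
    Real.circleAverage (fun z => ‖deriv (mobius a) z‖) 0 r ≤ 1 := by
  rw [mem_ball_zero_iff] at ha
  have hra0 : 0 ≤ r * ‖a‖ := mul_nonneg hr.1.le (norm_nonneg a)
  have hra : r * ‖a‖ < 1 := mul_lt_one_of_nonneg_of_lt_one_left hr.1.le hr.2 ha.le
  have hraa : r * ‖a‖ ≤ ‖a‖ := mul_le_of_le_one_left (norm_nonneg a) hr.2.le
  have hra' : 0 < 1 - (r * ‖a‖) ^ 2 :=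
    sub_pos.2 (pow_lt_one₀ hra0 hra two_ne_zero)
  have hball : (r ^ 2 * a : ℂ) ∈ Metric.ball 0 r := by
    rw [mem_ball_zero_iff, norm_mul, norm_pow, Complex.norm_real, Real.norm_of_nonneg hr.1.le, sq,
      mul_assoc]
    exact mul_lt_of_lt_one_right hr.1 hra
  have hkernel : ∀ z ∈ Metric.sphere (0 : ℂ) |r|, ‖deriv (mobius a) z‖ =
      (1 - ‖a‖ ^ 2) / (1 - (r * ‖a‖) ^ 2) * poissonKernel 0 (r ^ 2 * a) z := by
    intro z hz
    rw [mem_sphere_zero_iff_norm, abs_of_pos hr.1] at hz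
    rw [poissonKernel_sq_mul hr.1.ne' hz, norm_deriv_mobius (mem_ball_zero_iff.2 ha)
      (mem_ball_zero_iff.2 (hz.trans_lt hr.2)), div_mul_div_cancel₀ hra'.ne']
  rw [Real.circleAverage_congr_sphere hkernel]
  have h := Real.circleAverage_fun_smul (a := (1 - ‖a‖ ^ 2) / (1 - (r * ‖a‖) ^ 2))
    (f := poissonKernel 0 (r ^ 2 * a)) (c := 0) (R := r)
  simp only [smul_eq_mul] at h
  rw [h, circleAverage_poissonKernel hball, mul_one, div_le_one hra']
  gcongr

/-- A branch of `φ' ^ (1 / p)` for `φ = mobius a`, up to a unimodular constant. -/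
noncomputable def mobiusDerivRoot (p : ℝ) (a w : ℂ) : ℂ :=
  ((1 - ‖a‖ ^ 2 : ℝ) : ℂ) ^ ((1 / p : ℝ) : ℂ) * (1 - conj a * w) ^ ((-2 / p : ℝ) : ℂ)

lemma norm_mobiusDerivRoot_rpow (hp : p ≠ 0) (ha : a ∈ disc) (hz : z ∈ disc) :
    ‖mobiusDerivRoot p a z‖ ^ p = ‖deriv (mobius a) z‖ := by
  have h0 := (one_sub_norm_sq_pos ha).le
  rw [mobiusDerivRoot, norm_mul, Complex.norm_cpow_real, Complex.norm_cpow_real,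
    Real.mul_rpow (by positivity) (by positivity), ← Real.rpow_mul (norm_nonneg _),
    ← Real.rpow_mul (norm_nonneg _), one_div_mul_cancel hp, div_mul_cancel₀ _ hp, Real.rpow_one,
    Complex.norm_real, Real.norm_of_nonneg h0, Real.rpow_neg (norm_nonneg _), ← div_eq_mul_inv,
    Real.rpow_two, norm_deriv_mobius ha hz]

lemma differentiableOn_mobiusDerivRoot (p : ℝ) (ha : a ∈ disc) :
    DifferentiableOn ℂ (mobiusDerivRoot p a) disc := fun _ hz =>
  (((hasDerivAt_one_sub_conj_mul a _).differentiableAt.cpow (differentiableAt_const _)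
    (Or.inl (re_one_sub_conj_mul_pos ha hz))).const_mul _).differentiableWithinAt

lemma circleMean_mobiusDerivRoot_le_one (hp : 0 < p) (ha : a ∈ disc) (hr : r ∈ Set.Ioo 0 1) :
    circleMean p (mobiusDerivRoot p a) r ≤ 1 := by
  have hsub : Metric.sphere 0 |r| ⊆ disc := by
    rw [abs_of_pos hr.1]
    exact Metric.sphere_subset_ball hr.2
  rw [circleMean_eq_ofReal_circleAverage hp.le
    ((differentiableOn_mobiusDerivRoot p ha).continuousOn.mono hsub),
    Real.circleAverage_congr_sphere fun z hz => norm_mobiusDerivRoot_rpow hp.ne' ha (hsub hz)]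
  exact ENNReal.ofReal_le_one.2 (circleAverage_norm_deriv_mobius_le_one ha hr)

lemma hardyNorm_mobiusDerivRoot_le_one (hp : 0 < p) (ha : a ∈ disc) :
    hardyNorm p (mobiusDerivRoot p a) ≤ 1 := by
  refine limsup_le_of_le (by isBoundedDefault) ?_
  filter_upwards [Ioo_mem_nhdsLT (zero_lt_one' ℝ)] with r hr
  exact ENNReal.rpow_le_one (circleMean_mobiusDerivRoot_le_one hp ha hr) (by positivity)

lemma IsCarlesonMeasure.exists_lintegral_norm_deriv_mobius_le {μ : Measure ℂ} (hp : 0 < p)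
    (h : IsCarlesonMeasure p μ) :
    ∃ C : ℝ≥0, ∀ a ∈ disc, ∫⁻ w in disc, ENNReal.ofReal ‖deriv (mobius a) w‖ ∂μ ≤ C := by
  obtain ⟨C, -, hC⟩ := h
  refine ⟨C, fun a ha => ?_⟩
  have hnorm := hardyNorm_mobiusDerivRoot_le_one hp ha
  calc _ = ∫⁻ w in disc, ENNReal.ofReal (‖mobiusDerivRoot p a w‖ ^ p) ∂μ :=
        setLIntegral_congr_fun measurableSet_ball fun w hw => by
          rw [norm_mobiusDerivRoot_rpow hp.ne' ha hw]
    _ ≤ C * hardyNorm p (mobiusDerivRoot p a) ^ p :=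
        hC _ ⟨differentiableOn_mobiusDerivRoot p ha, hnorm.trans_lt ENNReal.one_lt_top⟩
    _ ≤ C := mul_le_of_le_one_right' (ENNReal.rpow_le_one hnorm hp.le)

end Hardy

section ChangeOfVariables

variable {A : ℂ → ℂ} {a : ℂ}

lemma lintegral_image_eq_lintegral_norm_deriv_sq_mul {s : Set ℂ} (hs : MeasurableSet s)
    {φ φ' : ℂ → ℂ} (hφ : ∀ z ∈ s, HasDerivWithinAt φ (φ' z) s z) (hinj : Set.InjOn φ s)
    (g : ℂ → ℝ≥0∞) :
    ∫⁻ w in φ '' s, g w = ∫⁻ z in s, ENNReal.ofReal (‖φ' z‖ ^ 2) * g (φ z) := by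
  rw [lintegral_image_eq_lintegral_abs_det_fderiv_mul volume hs
    (f' := fun z => (ContinuousLinearMap.toSpanSingleton ℂ (φ' z)).restrictScalars ℝ)
    (fun z hz => (hφ z hz).hasFDerivWithinAt.restrictScalars ℝ) hinj g]
  refine setLIntegral_congr_fun hs fun z _ => ?_
  have hdet : ((ContinuousLinearMap.toSpanSingleton ℂ (φ' z)).restrictScalars ℝ).det =
      ‖φ' z‖ ^ 2 := by
    simp [ContinuousLinearMap.det, LinearMap.det_restrictScalars, Algebra.norm_complex_eq,
      Complex.normSq_eq_norm_sq]
  simp only [hdet, abs_pow, abs_norm]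

lemma lintegral_coeffMeasure (hA : ContinuousOn A disc) (g : ℂ → ℝ≥0∞) :
    ∫⁻ w in disc, g w ∂(coeffMeasure A) =
      ∫⁻ w in disc, ENNReal.ofReal (‖A w‖ * (1 - ‖w‖ ^ 2)) * g w := by
  have hAc : ContinuousOn (fun w => ‖A w‖ * (1 - ‖w‖ ^ 2)) disc := by fun_prop
  rw [coeffMeasure, restrict_withDensity measurableSet_ball,
    Measure.restrict_restrict measurableSet_ball, Set.inter_self]
  exact lintegral_withDensity_eq_lintegral_mul_non_measurable₀ _
    (hAc.aemeasurable measurableSet_ball).ennreal_ofReal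
    (Eventually.of_forall fun _ => ENNReal.ofReal_lt_top) g

/-- The weight `1 - |z|²` transforms with the factor `|φ'|`, so that only one of the three factors
`|φ'|` in `|B (φ⁻¹)| (1 - |φ⁻¹|²) dm` is left. -/
lemma lintegral_coeffPullback (hA : ContinuousOn A disc) (ha : a ∈ disc) :
    ∫⁻ z in disc, ENNReal.ofReal (‖coeffPullback A a z‖ * (1 - ‖z‖ ^ 2)) =
      ∫⁻ w in disc, ENNReal.ofReal ‖deriv (mobius a) w‖ ∂(coeffMeasure A) := by
  rw [lintegral_coeffMeasure hA]
  conv_rhs => rw [← image_mobius_disc ha]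
  rw [lintegral_image_eq_lintegral_norm_deriv_sq_mul measurableSet_ball
    (fun z hz => (hasDerivAt_mobius ha hz).differentiableAt.hasDerivAt.hasDerivWithinAt)
    (injOn_mobius ha)]
  refine setLIntegral_congr_fun measurableSet_ball fun z hz => ?_
  have hinv := norm_deriv_mobius_mobius_mul ha hz
  have hφ := (one_sub_norm_sq_pos (mobius_mem_disc ha hz)).le
  rw [← ENNReal.ofReal_mul (by positivity), ← ENNReal.ofReal_mul (by positivity),
    one_sub_norm_mobius_sq ha hz, coeffPullback, norm_mul, norm_pow]
  congr 1
  linear_combination (-(‖A (mobius a z)‖ * ‖deriv (mobius a) z‖ ^ 2 * (1 - ‖z‖ ^ 2))) * hinv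

end ChangeOfVariables

section PolarCoordinates

variable {E : Type*} [NormedAddCommGroup E] [NormedSpace ℝ E] {k : ℂ → E} {r : ℝ}

lemma continuousOn_uncurry_circleMap (hk : ContinuousOn k (Metric.closedBall 0 r)) (t : Set ℝ) :
    ContinuousOn (fun q : ℝ × ℝ => q.1 • k (circleMap 0 q.1 q.2)) (Set.Icc 0 r ×ˢ t) := by
  refine continuousOn_fst.smul (hk.comp ?_ fun q hq => ?_)
  · simp only [circleMap]
    fun_prop
  · simpa [abs_of_nonneg hq.1.1] using hq.1.2

lemma setIntegral_ball_eq_setIntegral_prod (k : ℂ → E) (r : ℝ) :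
    ∫ z in Metric.ball 0 r, k z = ∫ q in Set.Ioo 0 r ×ˢ Set.Ioo (-Real.pi) Real.pi,
      q.1 • k (circleMap 0 q.1 q.2) := by
  have hsymm : ∀ q : ℝ × ℝ, Complex.polarCoord.symm q = circleMap 0 q.1 q.2 := fun q => by
    rw [Complex.polarCoord_symm_apply, circleMap_zero, Complex.exp_mul_I, Complex.ofReal_cos,
      Complex.ofReal_sin]
  rw [← integral_indicator measurableSet_ball, ← Complex.integral_comp_polarCoord_symm,
    polarCoord_target]
  simp only [hsymm]
  rw [setIntegral_eq_of_subset_of_forall_sdiff_eq_zero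
    (measurableSet_Ioi.prod measurableSet_Ioo) (s := Set.Ioo 0 r ×ˢ Set.Ioo (-Real.pi) Real.pi)
    (Set.prod_mono_left Set.Ioo_subset_Ioi_self)]
  · refine setIntegral_congr_fun (measurableSet_Ioo.prod measurableSet_Ioo) fun q hq => ?_
    rw [Set.indicator_of_mem]
    simpa [abs_of_pos hq.1.1] using hq.1.2
  · rintro q ⟨hq, hqr⟩
    rw [Set.indicator_of_notMem, smul_zero]
    intro hball
    rw [mem_ball_zero_iff, norm_circleMap_zero, abs_of_pos hq.1] at hball
    exact hqr ⟨⟨hq.1, hball⟩, hq.2⟩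

lemma integrableOn_prod_circleMap (hk : ContinuousOn k (Metric.closedBall 0 r)) :
    IntegrableOn (fun q : ℝ × ℝ => q.2 • k (circleMap 0 q.2 q.1))
      (Set.Ioo (-Real.pi) Real.pi ×ˢ Set.Ioo 0 r) (volume.prod volume) :=
  IntegrableOn.swap (((continuousOn_uncurry_circleMap hk _).integrableOn_compact
    (isCompact_Icc.prod isCompact_Icc)).mono_set
      (Set.prod_mono Set.Ioo_subset_Icc_self Set.Ioo_subset_Icc_self))

lemma periodic_integral_circleMap (k : ℂ → E) (r : ℝ) :
    Function.Periodic (fun θ => ∫ s in 0..r, s • k (circleMap 0 s θ)) (2 * Real.pi) :=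
  fun θ => by simp only [periodic_circleMap 0 _ θ]

lemma intervalIntegrable_integral_circleMap (hr : 0 ≤ r)
    (hk : ContinuousOn k (Metric.closedBall 0 r)) (a b : ℝ) :
    IntervalIntegrable (fun θ => ∫ s in 0..r, s • k (circleMap 0 s θ)) volume a b := by
  refine (periodic_integral_circleMap k r).intervalIntegrable Real.two_pi_pos.ne'
    (t := -Real.pi) ?_ a b
  rw [intervalIntegrable_iff_integrableOn_Ioo_of_le (by linarith [Real.pi_pos]),
    show -Real.pi + 2 * Real.pi = Real.pi by ring]
  have h := integrableOn_prod_circleMap hk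
  rw [IntegrableOn, ← Measure.prod_restrict] at h
  simpa only [IntegrableOn, intervalIntegral.integral_of_le hr, integral_Ioc_eq_integral_Ioo] using
    h.integral_prod_left

lemma setIntegral_ball_eq_integral_integral_circleMap (hr : 0 ≤ r)
    (hk : ContinuousOn k (Metric.closedBall 0 r)) :
    ∫ z in Metric.ball 0 r, k z =
      ∫ θ in 0..2 * Real.pi, ∫ s in 0..r, s • k (circleMap 0 s θ) := by
  have hshift := (periodic_integral_circleMap k r).intervalIntegral_add_eq 0 (-Real.pi)
  rw [zero_add, show -Real.pi + 2 * Real.pi = Real.pi by ring] at hshift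
  rw [setIntegral_ball_eq_setIntegral_prod, Measure.volume_eq_prod, ← setIntegral_prod_swap]
  simp only [Prod.fst_swap, Prod.snd_swap]
  rw [setIntegral_prod _ (integrableOn_prod_circleMap hk), hshift,
    intervalIntegral.integral_of_le (by linarith [Real.pi_pos]), integral_Ioc_eq_integral_Ioo]
  simp only [intervalIntegral.integral_of_le hr, integral_Ioc_eq_integral_Ioo]

end PolarCoordinates

section Growth

variable {B u : ℂ → ℂ} {r : ℝ} {C : ℝ≥0}

lemma IsSolution.norm_circleMap_le (hB : ContinuousOn B disc) (hu : IsSolution B u) (hu0 : u 0 = 0)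
    (hr : r ∈ Set.Ioo 0 1) (θ : ℝ) :
    ‖u (circleMap 0 r θ)‖ ≤ r * ‖deriv u 0‖ * Real.exp
      (∫ s in 0..r, s * (‖B (circleMap 0 s θ)‖ * (1 - ‖circleMap 0 s θ‖ ^ 2))) := by
  set e : ℂ := Complex.exp (θ * Complex.I)
  have he : ‖e‖ = 1 := Complex.norm_exp_ofReal_mul_I θ
  have hmem : ∀ s ∈ Set.Icc 0 r, (s : ℂ) * e ∈ disc := fun s hs => by
    simpa [he, abs_of_nonneg hs.1] using hs.2.trans_lt hr.2
  have hray : ∀ s : ℝ, HasDerivAt (fun s : ℝ => (s : ℂ) * e) e s := fun s => by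
    simpa using (Complex.ofRealCLM.hasDerivAt (x := s)).mul_const e
  have hBc : ContinuousOn (fun s : ℝ => B (s * e)) (Set.Icc 0 r) := hB.comp (by fun_prop) hmem
  have huc : ContinuousOn (fun s : ℝ => u (s * e)) (Set.Icc 0 r) :=
    hu.1.continuousOn.comp (by fun_prop) hmem
  have hgrowth := norm_le_mul_exp_integral_of_norm_deriv_deriv_le hr.1
    (fun s hs => (hu.hasDerivAt (hmem s hs)).comp s (hray s))
    (fun s hs => ((hu.hasDerivAt_deriv (hmem s hs)).comp s (hray s)).mul_const e)
    (((hBc.mul huc).neg.mul_const e).mul_const e) hBc.norm (fun s _ => norm_nonneg _)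
    (fun s _ => by simp [he]) (by simpa using hu0)
  simp only [Function.comp_apply, Complex.ofReal_zero, zero_mul, norm_mul (deriv u 0), he,
    mul_one] at hgrowth
  have hcircle : ∀ s : ℝ, circleMap 0 s θ = s * e := fun s => circleMap_zero s θ
  simp only [hcircle]
  refine hgrowth.trans (mul_le_mul_of_nonneg_left (Real.exp_le_exp.2 ?_)
    (mul_nonneg hr.1.le (norm_nonneg _)))
  refine intervalIntegral.integral_mono_on hr.1.le
    ((continuousOn_id.mul (ContinuousOn.mul (by fun_prop) hBc.norm)).intervalIntegrable_of_Icc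
      hr.1.le)
    ((continuousOn_id.mul (hBc.norm.mul (by fun_prop))).intervalIntegrable_of_Icc hr.1.le)
    fun s hs => ?_
  have hweight : 1 - s / r ≤ 1 - ‖(s : ℂ) * e‖ ^ 2 := by
    rw [norm_mul, he, mul_one, Complex.norm_real, Real.norm_of_nonneg hs.1, sub_le_sub_iff_left,
      le_div_iff₀ hr.1]
    nlinarith [hs.1, hs.2, hr.1, hr.2]
  rw [mul_comm (1 - s / r)]
  have := hs.1
  gcongr

lemma IsSolution.log_norm_dslope_div_deriv_le (hB : ContinuousOn B disc) (hu : IsSolution B u)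
    (hu0 : u 0 = 0) (hr : r ∈ Set.Ioo 0 1) (θ : ℝ) :
    Real.log ‖dslope u 0 (circleMap 0 r θ) / deriv u 0‖ ≤
      ∫ s in 0..r, s * (‖B (circleMap 0 s θ)‖ * (1 - ‖circleMap 0 s θ‖ ^ 2)) := by
  set I := ∫ s in 0..r, s * (‖B (circleMap 0 s θ)‖ * (1 - ‖circleMap 0 s θ‖ ^ 2))
  have hI : 0 ≤ I := intervalIntegral.integral_nonneg hr.1.le fun s hs => by
    have hs' : circleMap 0 s θ ∈ disc := by
      simpa [abs_of_nonneg hs.1] using hs.2.trans_lt hr.2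
    exact mul_nonneg hs.1 (mul_nonneg (norm_nonneg _) (one_sub_norm_sq_pos hs').le)
  have hle : ‖dslope u 0 (circleMap 0 r θ) / deriv u 0‖ ≤ Real.exp I := by
    rw [dslope_of_ne _ (circleMap_ne_center hr.1.ne'), slope_def_field, hu0, sub_zero, sub_zero,
      div_div, norm_div, norm_mul, norm_circleMap_zero, abs_of_pos hr.1]
    have := hr.1
    exact div_le_of_le_mul₀ (by positivity) (Real.exp_pos I).le
      ((hu.norm_circleMap_le hB hu0 hr θ).trans_eq (mul_comm _ _))
  rcases (norm_nonneg (dslope u 0 (circleMap 0 r θ) / deriv u 0)).eq_or_lt with h | h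
  · rwa [← h, Real.log_zero]
  · exact (Real.log_le_iff_le_exp h).2 hle

lemma IsSolution.analyticOnNhd_dslope (hu : IsSolution B u) :
    AnalyticOnNhd ℂ (fun z => dslope u 0 z / deriv u 0) disc :=
  ((((Complex.differentiableOn_dslope (Metric.ball_mem_nhds 0 one_pos)).2 hu.1).div_const
    _).analyticOnNhd Metric.isOpen_ball)

lemma IsSolution.circleAverage_log_norm_dslope_le (hB : ContinuousOn B disc) (hu : IsSolution B u)
    (hu0 : u 0 = 0) (hr : r ∈ Set.Ioo 0 1) :
    Real.circleAverage (fun z => Real.log ‖dslope u 0 z / deriv u 0‖) 0 r ≤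
      (2 * Real.pi)⁻¹ * ∫ z in Metric.ball 0 r, ‖B z‖ * (1 - ‖z‖ ^ 2) := by
  have hsub : Metric.closedBall (0 : ℂ) r ⊆ disc := Metric.closedBall_subset_ball hr.2
  have hk : ContinuousOn (fun z => ‖B z‖ * (1 - ‖z‖ ^ 2)) (Metric.closedBall 0 r) := by
    have := hB.mono hsub
    fun_prop
  have hint : CircleIntegrable (fun z => Real.log ‖dslope u 0 z / deriv u 0‖) 0 r :=
    MeromorphicOn.circleIntegrable_log_norm fun z hz =>
      (hu.analyticOnNhd_dslope z (hsub (Metric.sphere_subset_closedBall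
        (by rwa [abs_of_pos hr.1] at hz)))).meromorphicAt
  rw [Real.circleAverage_def, smul_eq_mul,
    setIntegral_ball_eq_integral_integral_circleMap hr.1.le hk]
  simp only [smul_eq_mul]
  gcongr
  exact intervalIntegral.integral_mono_on Real.two_pi_pos.le hint
    (intervalIntegrable_integral_circleMap hr.1.le hk 0 _)
    fun θ _ => hu.log_norm_dslope_div_deriv_le hB hu0 hr θ

lemma IsSolution.sum_log_le_setIntegral (hB : ContinuousOn B disc) (hu : IsSolution B u)
    (hu0 : u 0 = 0) (hu0' : deriv u 0 ≠ 0) (hr : r ∈ Set.Ioo 0 1) {F : Finset ℂ}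
    (hF : ∀ w ∈ F, ‖w‖ ≤ r ∧ w ≠ 0 ∧ u w = 0) :
    ∑ w ∈ F, Real.log (r * ‖w‖⁻¹) ≤
      (2 * Real.pi)⁻¹ * ∫ z in Metric.ball 0 r, ‖B z‖ * (1 - ‖z‖ ^ 2) := by
  have hg0 : dslope u 0 0 / deriv u 0 = 1 := by rw [dslope_same, div_self hu0']
  have hjensen := sum_log_le_circleAverage_log_norm hr.1
    (hu.analyticOnNhd_dslope.mono (Metric.closedBall_subset_ball hr.2)) (hg0 ▸ one_ne_zero)
    (fun w hw => mem_closedBall_zero_iff.2 (hF w hw).1)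
    fun w hw => by simp [dslope_of_ne _ (hF w hw).2.1, slope_def_field, (hF w hw).2.2, hu0]
  simp only [hg0, norm_one, Real.log_one, add_zero, zero_sub, norm_neg] at hjensen
  exact hjensen.trans (hu.circleAverage_log_norm_dslope_le hB hu0 hr)

lemma setIntegral_ball_le_of_lintegral_le {k : ℂ → ℝ} (hk : ContinuousOn k disc)
    (hk0 : ∀ z ∈ disc, 0 ≤ k z) (hC : ∫⁻ z in disc, ENNReal.ofReal (k z) ≤ C) (hr : r < 1) :
    ∫ z in Metric.ball 0 r, k z ≤ C := by
  have hsub : Metric.ball (0 : ℂ) r ⊆ disc := Metric.ball_subset_ball hr.le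
  rw [integral_eq_lintegral_of_nonneg_ae
    ((ae_restrict_iff' measurableSet_ball).2 (Eventually.of_forall fun z hz => hk0 z (hsub hz)))
    ((hk.mono hsub).aestronglyMeasurable measurableSet_ball)]
  exact ENNReal.toReal_le_coe_of_le_coe ((lintegral_mono_set hsub).trans hC)

theorem IsSolution.exp_neg_le_prod_norm (hB : ContinuousOn B disc) (hu : IsSolution B u)
    (hu0 : u 0 = 0) (hu0' : deriv u 0 ≠ 0)
    (hC : ∫⁻ z in disc, ENNReal.ofReal (‖B z‖ * (1 - ‖z‖ ^ 2)) ≤ C) {F : Finset ℂ}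
    (hF : ∀ w ∈ F, w ∈ disc ∧ w ≠ 0 ∧ u w = 0) :
    Real.exp (-((2 * Real.pi)⁻¹ * C)) ≤ ∏ w ∈ F, ‖w‖ := by
  have hF0 : ∀ w ∈ F, ‖w‖ ≠ 0 := fun w hw => norm_ne_zero_iff.2 (hF w hw).2.1
  have hlim : Tendsto (fun r : ℝ => ∑ w ∈ F, Real.log (r * ‖w‖⁻¹)) (𝓝[<] 1)
      (𝓝 (∑ w ∈ F, Real.log (1 * ‖w‖⁻¹))) :=
    tendsto_nhdsWithin_of_tendsto_nhds (tendsto_finsetSum _ fun w hw =>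
      ((continuousAt_id.mul_const _).log (by simpa using hF0 w hw)).tendsto)
  have hmem : ∀ᶠ r : ℝ in 𝓝[<] 1, ∀ w ∈ F, ‖w‖ ≤ r := by
    rw [Filter.eventually_all_finset]
    intro w hw
    filter_upwards [Ioo_mem_nhdsLT (mem_ball_zero_iff.1 (hF w hw).1)] with r hr using hr.1.le
  have hsum : ∑ w ∈ F, Real.log (1 * ‖w‖⁻¹) ≤ (2 * Real.pi)⁻¹ * C := by
    refine le_of_tendsto hlim ?_
    filter_upwards [hmem, Ioo_mem_nhdsLT (zero_lt_one' ℝ)] with r hFr hr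
    refine (hu.sum_log_le_setIntegral hB hu0 hu0' hr fun w hw =>
      ⟨hFr w hw, (hF w hw).2⟩).trans ?_
    gcongr
    exact setIntegral_ball_le_of_lintegral_le (by fun_prop)
      (fun z hz => mul_nonneg (norm_nonneg _) (one_sub_norm_sq_pos hz).le) hC hr.2
  rw [← Real.le_log_iff_exp_le (Finset.prod_pos fun w hw => norm_pos_iff.2 (hF w hw).2.1),
    Real.log_prod hF0]
  simp only [one_mul, Real.log_inv, Finset.sum_neg_distrib] at hsum
  linarith

/-- `solutionPullback f a` vanishes at the points `mobius a w`, whose moduli are the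
pseudo-hyperbolic distances from `w` to `a`. -/
theorem IsSolution.exp_neg_le_prod_pseudoDist {A f : ℂ → ℂ} {a : ℂ}
    (hA : DifferentiableOn ℂ A disc) (hf : IsSolution A f) (hf0 : ∃ z ∈ disc, f z ≠ 0)
    (ha : a ∈ disc) (hfa : f a = 0)
    (hC : ∫⁻ w in disc, ENNReal.ofReal ‖deriv (mobius a) w‖ ∂(coeffMeasure A) ≤ C) {F : Finset ℂ}
    (hF : ∀ w ∈ F, w ∈ disc ∧ w ≠ a ∧ f w = 0) :
    Real.exp (-((2 * Real.pi)⁻¹ * C)) ≤ ∏ w ∈ F, pseudoDist w a := by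
  classical
  have hinj : Set.InjOn (mobius a) F := (injOn_mobius ha).mono fun w hw => (hF w hw).1
  simp only [pseudoDist_eq_norm_mobius]
  rw [← Finset.prod_image (f := norm) hinj]
  refine (hf.solutionPullback ha).exp_neg_le_prod_norm
    (differentiableOn_coeffPullback hA ha).continuousOn (by simpa using hfa)
    (hf.deriv_solutionPullback_zero_ne_zero hA hf0 ha hfa)
    ((lintegral_coeffPullback hA.continuousOn ha).trans_le hC) fun w hw => ?_
  obtain ⟨w, hwF, rfl⟩ := Finset.mem_image.1 hw
  obtain ⟨hw, hwa, hfw⟩ := hF w hwF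
  refine ⟨mobius_mem_disc ha hw, fun h => hwa ?_, by simp [solutionPullback_mobius f ha hw, hfw]⟩
  rw [← mobius_mobius ha hw, h, mobius_zero]

end Growth

end DiskODE

theorem mainTheorem1 (p : ℝ) (hp : 0 < p) (A : ℂ → ℂ)
    (hA : DifferentiableOn ℂ A DiskODE.disc)
    (hcarl : DiskODE.IsCarlesonMeasure p (DiskODE.coeffMeasure A))
    (f : ℂ → ℂ) (hf : DiskODE.IsSolution A f) (hf0 : ∃ z ∈ DiskODE.disc, f z ≠ 0)
    {ι : Type*} (z : ι → ℂ) (hz : DiskODE.IsZeroSequence f z) :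
    DiskODE.UniformlySeparated z := by
  have hinj : Function.Injective z := hz.injective hA hf hf0
  obtain ⟨C, hC⟩ := hcarl.exists_lintegral_norm_deriv_mobius_le hp
  refine ⟨Real.exp (-((2 * Real.pi)⁻¹ * C)), Real.exp_pos _, fun k => ?_⟩
  refine DiskODE.multipliable_and_le_tprod_of_forall_le_prod (fun _ => norm_nonneg _)
    (fun n => DiskODE.pseudoDist_le_one (hz.1 n) (hz.1 k)) fun s => ?_
  have hprod := hf.exp_neg_le_prod_pseudoDist hA hf0 (hz.1 k) (hz.apply_eq_zero k) (hC _ (hz.1 k))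
    (F := s.map ⟨fun n : {n // n ≠ k} => z n, hinj.comp Subtype.val_injective⟩) fun w hw => by
      obtain ⟨n, -, rfl⟩ := Finset.mem_map.1 hw
      exact ⟨hz.1 n, hinj.ne n.2, hz.apply_eq_zero n⟩
  simpa using hprod
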